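/- Let $\mathfrak g$ be the complex simple Lie algebra of type $E_6$ with Cartan subalgebra $\mathfrak h$ and simple roots $\alpha_1,\dots,\alpha_6$ (Bourbaki numbering), and let $\theta$ be the Cartan involution of $\mathfrak e_{6(-14)}$ which is the identity on $\mathfrak h$, is $-1$ on the root spaces of $\pm\alpha_1$ and is $1$ on those of $\pm\alpha_2,\dots,\pm\alpha_6$. Let $G$ be the simply connected complex group with Lie algebra $\mathfrak g$, $K=G^\theta$, and $B\subset G$ the Borel subgroup determined by $\mathfrak h$ and the positive roots (so $(G,K)$ corresponds to the group $\texttt{E6\_h}$ of the software atlas, with real Lie algebra $\mathfrak e_{6(-14)}$). A KGB element $x$ is a $K$-orbit on $G/B$. If $gB\in x$ is chosen such that $g\mathfrak h$ is $\theta$-stable, then $g^{-1}\theta g$ acts on $\mathfrak h$ and on $\mathfrak h^*$ by an involution $\theta_x$ in the Weyl group $W$; the support of $x$ is the set of simple reflections that occur in a reduced word for $\theta_x$, and $x$ is fully supported if all six of them occur. Let $\zeta_1,\dots,\zeta_6$ be the fundamental weights, $\rho$ half the sum of the positive roots, and $\|\cdot\|$ the norm on the real span of the roots given by a $W$-invariant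 inner product. Let $x$ be a fully supported KGB element. Then only finitely many dominant integral weights $\Lambda=a_1\zeta_1+\cdots+a_6\zeta_6$ with $a_1,\dots,a_6\in\mathbb Z_{\ge 0}$ satisfy $$\|\Lambda-\theta_x\Lambda\|\le\|2\rho\|.$$ Moreover, for $\Lambda=a_1\zeta_1+\cdots+a_6\zeta_6$, the quantity $\|\Lambda-\theta_x\Lambda\|^2$ is a homogeneous quadratic polynomial in $a_1,\dots,a_6$ in which the coefficient of every $a_i^2$ is positive and the coefficient of every $a_ia_j$ with $i<j$ is nonnegative. -/

import Mathlib

namespace E6h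

/-! ### The complex Lie algebra of type `E₆` and the Cartan involution of `EIII`

Index `i : Fin 6` stands for the simple root `α_{i+1}` in Bourbaki's numbering. -/

/-- The complex simple Lie algebra of type `E₆`. -/
abbrev 𝔤 : Type := LieAlgebra.e₆ ℂ

/-- The projection from the free Lie algebra on the Chevalley generators to `𝔤`. -/
noncomputable def proj : FreeLieAlgebra ℂ (CartanMatrix.Generators (Fin 6)) →ₗ⁅ℂ⁆ 𝔤 where
  toFun x := LieSubmodule.Quotient.mk (N := CartanMatrix.Relations.toIdeal ℂ CartanMatrix.E₆) x
  map_add' _ _ := rfl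
  map_smul' _ _ := rfl
  map_lie' := rfl

theorem proj_eq_zero {x : FreeLieAlgebra ℂ (CartanMatrix.Generators (Fin 6))}
    (hx : x ∈ CartanMatrix.Relations.toSet ℂ CartanMatrix.E₆) : proj x = 0 :=
  LieSubmodule.Quotient.mk_eq_zero'.mpr (LieSubmodule.subset_lieSpan hx)

theorem proj_surjective : Function.Surjective proj := Quot.mk_surjective

/-- The image in `𝔤` of a Chevalley generator. -/
noncomputable def gen (s : CartanMatrix.Generators (Fin 6)) : 𝔤 := proj (FreeLieAlgebra.of ℂ s)

/-- The simple coroots `H_i`; they span the standard Cartan subalgebra `𝔥`. -/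
noncomputable def H (i : Fin 6) : 𝔤 := gen (.H i)

/-- The simple root vectors `E_i`. -/
noncomputable def E (i : Fin 6) : 𝔤 := gen (.E i)

/-- The negative simple root vectors `F_i`. -/
noncomputable def F (i : Fin 6) : 𝔤 := gen (.F i)

/-- The Vogan diagram of `𝔢₆₍₋₁₄₎`: trivial diagram automorphism, `α₁` noncompact (sign `-1`) and
`α₂, …, α₆` compact (sign `1`). -/
def vogan (i : Fin 6) : ℂ := if i = 0 then -1 else 1

theorem vogan_mul_self (i : Fin 6) : vogan i * vogan i = 1 := by
  unfold vogan; split <;> norm_num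

/-- The scalars by which the Cartan involution acts on the Chevalley generators. -/
def voganSign : CartanMatrix.Generators (Fin 6) → ℂ
  | .H _ => 1
  | .E i => vogan i
  | .F i => vogan i

theorem voganSign_mul_self (s : CartanMatrix.Generators (Fin 6)) :
    voganSign s * voganSign s = 1 := by
  cases s <;> simp [voganSign, vogan_mul_self]

/-- The Cartan involution, on the free Lie algebra on the Chevalley generators. -/
noncomputable def thetaFree : FreeLieAlgebra ℂ (CartanMatrix.Generators (Fin 6)) →ₗ⁅ℂ⁆ 𝔤 :=
  FreeLieAlgebra.lift ℂ fun s => voganSign s • gen s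

theorem thetaFree_of (s : CartanMatrix.Generators (Fin 6)) :
    thetaFree (FreeLieAlgebra.of ℂ s) = voganSign s • proj (FreeLieAlgebra.of ℂ s) :=
  FreeLieAlgebra.lift_of_apply _ s

/-- If a Lie homomorphism `f` agrees with `g` up to scalars on `x` and `y`, it does so on
`(ad x)^k y`. -/
theorem map_ad_pow {L L' : Type*} [LieRing L] [LieAlgebra ℂ L] [LieRing L'] [LieAlgebra ℂ L']
    (f g : L →ₗ⁅ℂ⁆ L') {x y : L} {a b : ℂ} (hx : f x = a • g x) (hy : f y = b • g y) (k : ℕ) :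
    f ((LieAlgebra.ad ℂ L x ^ k) y) = (a ^ k * b) • g ((LieAlgebra.ad ℂ L x ^ k) y) := by
  induction k with
  | zero => simpa using hy
  | succ k ih =>
    rw [pow_succ', Module.End.mul_apply, LieAlgebra.ad_apply, LieHom.map_lie, LieHom.map_lie, ih,
      hx, smul_lie, lie_smul, smul_smul, pow_succ']
    congr 1
    ring

theorem map_lie_smul {L L' : Type*} [LieRing L] [LieAlgebra ℂ L] [LieRing L'] [LieAlgebra ℂ L']
    (f g : L →ₗ⁅ℂ⁆ L') {x y : L} {a b : ℂ} (hx : f x = a • g x) (hy : f y = b • g y) :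
    f ⁅x, y⁆ = (a * b) • g ⁅x, y⁆ := by
  simpa using map_ad_pow f g hx hy 1

/-- Each defining relation of `𝔤` is an eigenvector of the Cartan involution. -/
theorem thetaFree_relation {x : FreeLieAlgebra ℂ (CartanMatrix.Generators (Fin 6))}
    (hx : x ∈ CartanMatrix.Relations.toSet ℂ CartanMatrix.E₆) :
    ∃ c : ℂ, thetaFree x = c • proj x := by
  have hg := thetaFree_of
  rcases hx with ((((hx | hx) | hx) | hx) | hx) | hx <;> obtain ⟨⟨i, j⟩, rfl⟩ := hx
  · exact ⟨_, map_lie_smul thetaFree proj (hg (.H i)) (hg (.H j))⟩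
  · simp only [CartanMatrix.Relations.EF, Function.uncurry_apply_pair, Function.comp_apply]
    split
    · subst j
      refine ⟨1, ?_⟩
      rw [map_sub, map_sub, map_lie_smul thetaFree proj (hg (.E i)) (hg (.F i)), hg]
      simp [voganSign, vogan_mul_self]
    · exact ⟨_, map_lie_smul thetaFree proj (hg (.E i)) (hg (.F j))⟩
  · refine ⟨vogan j, ?_⟩
    simp only [CartanMatrix.Relations.HE, Function.uncurry_apply_pair, Function.comp_apply]
    rw [map_sub, map_sub, map_lie_smul thetaFree proj (hg (.H i)) (hg (.E j)), map_zsmul,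
      map_zsmul, hg, smul_sub, smul_comm]
    simp [voganSign]
  · refine ⟨vogan j, ?_⟩
    simp only [CartanMatrix.Relations.HF, Function.uncurry_apply_pair, Function.comp_apply]
    rw [map_add, map_add, map_lie_smul thetaFree proj (hg (.H i)) (hg (.F j)), map_zsmul,
      map_zsmul, hg, smul_add, smul_comm]
    simp [voganSign]
  · exact ⟨_, map_ad_pow thetaFree proj (hg (.E i))
      (map_lie_smul thetaFree proj (hg (.E i)) (hg (.E j))) _⟩
  · exact ⟨_, map_ad_pow thetaFree proj (hg (.F i))
      (map_lie_smul thetaFree proj (hg (.F i)) (hg (.F j))) _⟩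

theorem toIdeal_le_ker :
    CartanMatrix.Relations.toIdeal ℂ CartanMatrix.E₆ ≤ thetaFree.ker := by
  refine LieSubmodule.lieSpan_le.mpr fun x hx => ?_
  obtain ⟨c, hc⟩ := thetaFree_relation hx
  rw [proj_eq_zero hx, smul_zero] at hc
  exact LieHom.mem_ker.mpr hc

/-- The Cartan involution of `𝔤` as a linear map. -/
noncomputable def thetaLin : 𝔤 →ₗ[ℂ] 𝔤 :=
  Submodule.liftQ (CartanMatrix.Relations.toIdeal ℂ CartanMatrix.E₆).toSubmodule
    (thetaFree : FreeLieAlgebra ℂ (CartanMatrix.Generators (Fin 6)) →ₗ[ℂ] 𝔤)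
    fun _ hx => LieHom.mem_ker.mp (toIdeal_le_ker hx)

theorem thetaLin_proj (x : FreeLieAlgebra ℂ (CartanMatrix.Generators (Fin 6))) :
    thetaLin (proj x) = thetaFree x := rfl

theorem thetaLin_gen (s : CartanMatrix.Generators (Fin 6)) :
    thetaLin (gen s) = voganSign s • gen s := thetaFree_of s

theorem thetaLin_lie (x y : 𝔤) : thetaLin ⁅x, y⁆ = ⁅thetaLin x, thetaLin y⁆ := by
  obtain ⟨x, rfl⟩ := proj_surjective x
  obtain ⟨y, rfl⟩ := proj_surjective y
  rw [← LieHom.map_lie, thetaLin_proj, thetaLin_proj, thetaLin_proj, LieHom.map_lie]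

theorem thetaLin_involutive : Function.Involutive thetaLin := by
  let t : 𝔤 →ₗ⁅ℂ⁆ 𝔤 := { thetaLin with map_lie' := fun {x y} => thetaLin_lie x y }
  have h : (t.comp t).comp proj = proj := FreeLieAlgebra.hom_ext fun s => by
    change thetaLin (thetaLin (gen s)) = gen s
    rw [thetaLin_gen, map_smul, thetaLin_gen, smul_smul, voganSign_mul_self, one_smul]
  intro x
  obtain ⟨x, rfl⟩ := proj_surjective x
  exact LieHom.congr_fun h x

/-- The Cartan involution `θ` of `𝔤` defining `𝔢₆₍₋₁₄₎`: the Lie algebra involution which is the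
identity on `𝔥`, is `-1` on `E₁, F₁` and `1` on `E_i, F_i` for the other simple roots. -/
noncomputable def theta : 𝔤 ≃ₗ[ℂ] 𝔤 := LinearEquiv.ofInvolutive thetaLin thetaLin_involutive

theorem theta_lie (x y : 𝔤) : theta ⁅x, y⁆ = ⁅theta x, theta y⁆ := thetaLin_lie x y

theorem theta_H (i : Fin 6) : theta (H i) = H i :=
  (thetaLin_gen (.H i)).trans (one_smul ℂ _)

theorem theta_E (i : Fin 6) : theta (E i) = vogan i • E i := thetaLin_gen (.E i)

theorem theta_F (i : Fin 6) : theta (F i) = vogan i • F i := thetaLin_gen (.F i)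

/-! ### The group, the Borel variety and the KGB elements -/

/-- The image of the complex group under the adjoint representation: the group of automorphisms
of `𝔤` generated by the `exp (ad X)` with `ad X` nilpotent.  (The kernel of `Ad` on the simply
connected group is its centre `ℤ/3`, which acts trivially on the Borel variety.) -/
noncomputable def G : Subgroup (𝔤 ≃ₗ[ℂ] 𝔤) :=
  Subgroup.closure {g | ∃ (X : 𝔤) (m : ℕ), (LieAlgebra.ad ℂ 𝔤 X) ^ m = 0 ∧
    ∀ Y, g Y = ∑ k ∈ Finset.range m, (k.factorial : ℂ)⁻¹ • ((LieAlgebra.ad ℂ 𝔤 X) ^ k) Y}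

/-- The standard Borel subalgebra, generated by `𝔥` and the simple root vectors. -/
noncomputable def borel : LieSubalgebra ℂ 𝔤 :=
  LieSubalgebra.lieSpan ℂ 𝔤 (Set.range H ∪ Set.range E)

/-- The Borel subgroup `B` of `G`: the stabilizer of the standard Borel subalgebra. -/
noncomputable def B : Subgroup G where
  carrier := {g | ∀ Y, g.1 Y ∈ borel ↔ Y ∈ borel}
  one_mem' _ := Iff.rfl
  mul_mem' {g h} hg hk Y := (hg (h.1 Y)).trans (hk Y)
  inv_mem' {g} hg Y := by
    have h := hg ((g⁻¹).1 Y)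
    rwa [← LinearEquiv.mul_apply, ← Subgroup.coe_mul, mul_inv_cancel, Subgroup.coe_one,
      LinearEquiv.coe_one, id, Iff.comm] at h

/-- The subgroup `K` of the `θ`-fixed elements of `G`.  (It is the image under `Ad` of the fixed
points of `θ` in the simply connected group: if `Ad g` is fixed then `g⁻¹ θ(g)` is central and of
order at most two, hence trivial, as the centre has order three.) -/
noncomputable def K : Subgroup G := (Subgroup.centralizer {theta}).subgroupOf G

/-- A KGB element: a `K`-orbit on the Borel variety `G/B`. -/
abbrev KGB : Type := MulAction.orbitRel.Quotient K (G ⧸ B)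

/-- The `K`-orbit of the point `gB`. -/
noncomputable def KGB.mk (g : G) : KGB := Quotient.mk _ (QuotientGroup.mk g : G ⧸ B)

/-! ### Roots and weights -/

/-- The space containing the root system of type `E₆`, with its invariant norm, normalized so that
roots have length `√2`. -/
abbrev V : Type := EuclideanSpace ℝ (Fin 8)

/-- The simple roots `α₁, …, α₆`. -/
noncomputable def simpleRoot : Fin 6 → V :=
  ![!₂[1/2, -1/2, -1/2, -1/2, -1/2, -1/2, -1/2, 1/2],
    !₂[1, 1, 0, 0, 0, 0, 0, 0],
    !₂[-1, 1, 0, 0, 0, 0, 0, 0],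
    !₂[0, -1, 1, 0, 0, 0, 0, 0],
    !₂[0, 0, -1, 1, 0, 0, 0, 0],
    !₂[0, 0, 0, -1, 1, 0, 0, 0]]

/-- The fundamental weights `ζ₁, …, ζ₆`. -/
noncomputable def fundWeight : Fin 6 → V :=
  ![!₂[0, 0, 0, 0, 0, -2/3, -2/3, 2/3],
    !₂[1/2, 1/2, 1/2, 1/2, 1/2, -1/2, -1/2, 1/2],
    !₂[-1/2, 1/2, 1/2, 1/2, 1/2, -5/6, -5/6, 5/6],
    !₂[0, 0, 1, 1, 1, -1, -1, 1],
    !₂[0, 0, 0, 1, 1, -2/3, -2/3, 2/3],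
    !₂[0, 0, 0, 0, 1, -1/3, -1/3, 1/3]]

theorem inner_simpleRoot (i j : Fin 6) :
    inner ℝ (simpleRoot i) (simpleRoot j) = (CartanMatrix.E₆ i j : ℝ) := by
  fin_cases i <;> fin_cases j <;>
    simp [simpleRoot, CartanMatrix.E₆, PiLp.inner_apply, Fin.sum_univ_eight,
      EuclideanSpace.real_norm_sq_eq] <;> norm_num

theorem inner_fundWeight_simpleRoot (i j : Fin 6) :
    inner ℝ (fundWeight i) (simpleRoot j) = if i = j then (1 : ℝ) else 0 := by
  fin_cases i <;> fin_cases j <;>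
    simp [simpleRoot, fundWeight, PiLp.inner_apply, Fin.sum_univ_eight] <;> norm_num

/-- The simple roots are combinations of the fundamental weights, so that the latter lie in (and
span) the span of the roots. -/
theorem simpleRoot_eq (j : Fin 6) :
    simpleRoot j = ∑ i, (CartanMatrix.E₆ i j : ℝ) • fundWeight i := by
  ext k
  fin_cases j <;> fin_cases k <;>
    simp [simpleRoot, fundWeight, CartanMatrix.E₆, Fin.sum_univ_six] <;> norm_num

/-- The weight `[a₁, …, a₆] = a₁ζ₁ + ⋯ + a₆ζ₆`. -/
noncomputable def weight (a : Fin 6 → ℝ) : V := ∑ i, a i • fundWeight i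

/-- The simple reflections. -/
noncomputable def simpleReflection (i : Fin 6) : V ≃ₗᵢ[ℝ] V :=
  (ℝ ∙ simpleRoot i)ᗮ.reflection

/-- The Weyl group. -/
noncomputable def W : Subgroup (V ≃ₗᵢ[ℝ] V) := Subgroup.closure (Set.range simpleReflection)

/-- The root system. -/
def roots : Set V := {β | ∃ w ∈ W, ∃ i, β = w (simpleRoot i)}

/-- The positive roots. -/
def positiveRoots : Set V := {β ∈ roots | ∃ c : Fin 6 → ℕ, β = ∑ i, c i • simpleRoot i}

/-- Half the sum of the positive roots. -/
noncomputable def rho : V := (1 / 2 : ℝ) • ∑ᶠ β ∈ positiveRoots, β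

/-- `l` is a reduced word for `w`. -/
def IsReducedWord (l : List (Fin 6)) (w : V ≃ₗᵢ[ℝ] V) : Prop :=
  (l.map simpleReflection).prod = w ∧
    ∀ l' : List (Fin 6), (l'.map simpleReflection).prod = w → l.length ≤ l'.length

/-- The set of the simple reflections that occur in a reduced word for `w`.  The support of a KGB
element `x` is the support of its involution `θ_x`, and `x` is fully supported if all simple
reflections belong to it. -/
def support (w : V ≃ₗᵢ[ℝ] V) : Set (Fin 6) := {i | ∃ l, IsReducedWord l w ∧ i ∈ l}

/-! ### The involution of a KGB element -/

/-- `w` is the involution `θ_x` of the KGB element `x`.  Namely, in the `K`-orbit `x` there is a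
Borel subgroup `gBg⁻¹` with `g𝔥` stable under `θ`, and `w` is the action of `θ` on `g𝔥`,
transported by `g` to the standard Cartan subalgebra `𝔥`, that is, the action of `g⁻¹θg` on `𝔥`.
Here `𝔥` and its dual are identified through the invariant form: `H_i` corresponds to `α_i`. -/
def IsInvolutionOf (x : KGB) (w : V ≃ₗᵢ[ℝ] V) : Prop :=
  w ∈ W ∧ ∃ g : G, KGB.mk g = x ∧ ∀ i, ∃ d : Fin 6 → ℤ,
    w (simpleRoot i) = ∑ j, d j • simpleRoot j ∧
    (g.1⁻¹ * theta * g.1) (H i) = ∑ j, d j • H j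

/-- The closed orbit through the base point has trivial involution. -/
theorem isInvolutionOf_one : IsInvolutionOf (KGB.mk 1) 1 := by
  refine ⟨one_mem _, 1, rfl, fun i => ⟨Pi.single i 1, ?_, ?_⟩⟩
  · simp [Pi.single_apply]
  · simp [Pi.single_apply, theta_H]

end E6h

/-! Write w = θ_x and v_i = ζ_i − wζ_i. Then Λ − wΛ = ∑ a_i v_i, so the coefficients of the
quadratic form are ⟨v_i, v_i⟩ and 2⟨v_i, v_j⟩. The argument works for every w in the Weyl group with
full support.

As w is an isometry, ⟨v_i, v_j⟩ = ⟨ζ_i, v_j⟩ + ⟨ζ_j, v_i⟩. Both terms are nonnegative, because v_i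
pairs nonnegatively with all fundamental weights (`isNonneg_fundWeight_sub`). Along a reduced word
for w, v_i gains a positive root at each letter s_i, so v_i ≠ 0 once s_i occurs
(`fundWeight_sub_ne_zero`). Finiteness follows because q_ii a_i² alone is at most the bound.

The facts needed about W come from the even root lattice: vectors of square length two have
coordinates of one sign, which leads to the exchange property `exists_wordProd_eq_mul`. -/

namespace E6h

/-! ### The root lattice and the signs of roots -/

/-- The element of the root lattice with the given coordinates in the simple roots. -/
noncomputable def latticePoint (c : Fin 6 → ℤ) : V := ∑ i, (c i : ℝ) • simpleRoot i

theorem inner_fundWeight_latticePoint (i : Fin 6) (c : Fin 6 → ℤ) :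
    inner ℝ (fundWeight i) (latticePoint c) = (c i : ℝ) := by
  simp [latticePoint, inner_sum, inner_smul_right, inner_fundWeight_simpleRoot]

theorem inner_latticePoint (c d : Fin 6 → ℤ) :
    inner ℝ (latticePoint c) (latticePoint d) =
      ((∑ i, ∑ j, c i * d j * CartanMatrix.E₆ i j : ℤ) : ℝ) := by
  rw [latticePoint, latticePoint, sum_inner, Int.cast_sum]
  refine Finset.sum_congr rfl fun i _ => ?_
  rw [inner_sum, Int.cast_sum]
  refine Finset.sum_congr rfl fun j _ => ?_
  rw [real_inner_smul_left, real_inner_smul_right, inner_simpleRoot]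
  push_cast
  ring

theorem latticePoint_sub (c d : Fin 6 → ℤ) :
    latticePoint (c - d) = latticePoint c - latticePoint d := by
  simp [latticePoint, sub_smul, Finset.sum_sub_distrib]

theorem latticePoint_single (i : Fin 6) (n : ℤ) :
    latticePoint (Pi.single i n) = (n : ℝ) • simpleRoot i := by
  rw [latticePoint, Finset.sum_eq_single i]
  · simp
  · intro j _ hj
    simp [hj]
  · simp

/-- The root lattice is even. -/
theorem even_inner_latticePoint_self (c : Fin 6 → ℤ) :
    ∃ n : ℤ, inner ℝ (latticePoint c) (latticePoint c) = 2 * (n : ℝ) := by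
  -- Half the quadratic form: the squares minus one product for each edge of the Dynkin diagram.
  refine ⟨c 0 ^ 2 + c 1 ^ 2 + c 2 ^ 2 + c 3 ^ 2 + c 4 ^ 2 + c 5 ^ 2
    - c 0 * c 2 - c 1 * c 3 - c 2 * c 3 - c 3 * c 4 - c 4 * c 5, ?_⟩
  rw [inner_latticePoint]
  simp [Fin.sum_univ_six, CartanMatrix.E₆]
  ring

/-- Nonzero elements of the root lattice have square length at least two. -/
theorem two_le_inner_latticePoint_self {c : Fin 6 → ℤ} (hc : c ≠ 0) :
    2 ≤ inner ℝ (latticePoint c) (latticePoint c) := by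
  have hne : latticePoint c ≠ 0 := fun h => hc <| funext fun i => by
    have hi := inner_fundWeight_latticePoint i c
    rw [h, inner_zero_right] at hi
    exact_mod_cast hi.symm
  have hpos : 0 < inner ℝ (latticePoint c) (latticePoint c) := real_inner_self_pos.mpr hne
  obtain ⟨n, hn⟩ := even_inner_latticePoint_self c
  rw [hn] at hpos ⊢
  have hn0 : (0 : ℝ) < n := by linarith
  have hn1 : (1 : ℤ) ≤ n := by exact_mod_cast hn0
  have : (1 : ℝ) ≤ n := by exact_mod_cast hn1
  linarith

theorem cartanMatrix_nonpos : ∀ i j : Fin 6, i ≠ j → CartanMatrix.E₆ i j ≤ 0 := by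
  intro i j hij
  fin_cases i <;> fin_cases j <;> simp_all [CartanMatrix.E₆]

/-- A root has coordinates of only one sign. -/
theorem nonneg_or_nonpos {c : Fin 6 → ℤ}
    (hc : inner ℝ (latticePoint c) (latticePoint c) = 2) : 0 ≤ c ∨ c ≤ 0 := by
  -- The positive and negative parts have disjoint supports, so only off-diagonal Cartan entries,
  -- all nonpositive, contribute. If both parts were nonzero, the square length would be at least 2
  -- + 2.
  have hcross : inner ℝ (latticePoint c⁺) (latticePoint c⁻) ≤ 0 := by
    rw [inner_latticePoint]
    refine Int.cast_nonpos.mpr <| Finset.sum_nonpos fun i _ => Finset.sum_nonpos fun j _ => ?_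
    rcases eq_or_ne i j with rfl | hij
    · have h0 : c⁺ i * c⁻ i = 0 := by
        rw [Pi.posPart_apply, Pi.negPart_apply]
        rcases le_total 0 (c i) with h | h
        · rw [negPart_eq_zero.mpr h, mul_zero]
        · rw [posPart_eq_zero.mpr h, zero_mul]
      rw [h0, zero_mul]
    · exact mul_nonpos_of_nonneg_of_nonpos
        (mul_nonneg (posPart_nonneg c i) (negPart_nonneg c j)) (cartanMatrix_nonpos i j hij)
  rw [← posPart_sub_negPart c, latticePoint_sub, real_inner_sub_sub_self] at hc
  by_contra! h
  have h1 := two_le_inner_latticePoint_self fun h' => h.1 (negPart_eq_zero.mp h')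
  have h2 := two_le_inner_latticePoint_self fun h' => h.2 (posPart_eq_zero.mp h')
  linarith

/-- The vectors of square length two in the root lattice. -/
def IsRoot (β : V) : Prop := ∃ c : Fin 6 → ℤ, β = latticePoint c ∧ inner ℝ β β = (2 : ℝ)

/-- The cone spanned by the simple roots, cut out by the fundamental weights. -/
def IsNonneg (v : V) : Prop := ∀ i, 0 ≤ inner ℝ (fundWeight i) v

theorem IsNonneg.zero : IsNonneg 0 := fun i => (inner_zero_right (fundWeight i)).ge

theorem IsNonneg.add {u v : V} (hu : IsNonneg u) (hv : IsNonneg v) : IsNonneg (u + v) :=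
  fun i => by rw [inner_add_right]; exact add_nonneg (hu i) (hv i)

theorem isNonneg_latticePoint {c : Fin 6 → ℤ} : IsNonneg (latticePoint c) ↔ 0 ≤ c := by
  simp [IsNonneg, inner_fundWeight_latticePoint, Pi.le_def]

theorem isRoot_simpleRoot (i : Fin 6) : IsRoot (simpleRoot i) := by
  refine ⟨Pi.single i 1, by simp [latticePoint_single], ?_⟩
  rw [inner_simpleRoot]
  fin_cases i <;> simp [CartanMatrix.E₆]

theorem inner_simpleRoot_self (i : Fin 6) :
    inner ℝ (simpleRoot i) (simpleRoot i) = (2 : ℝ) := (isRoot_simpleRoot i).choose_spec.2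

theorem IsRoot.ne_zero {β : V} (hβ : IsRoot β) : β ≠ 0 := by
  rintro rfl
  obtain ⟨_, _, h⟩ := hβ
  simp at h

theorem IsRoot.isNonneg_or {β : V} (hβ : IsRoot β) : IsNonneg β ∨ IsNonneg (-β) := by
  obtain ⟨c, rfl, hc⟩ := hβ
  have hneg : -latticePoint c = latticePoint (-c) := by simp [latticePoint]
  rw [hneg, isNonneg_latticePoint, isNonneg_latticePoint, neg_nonneg]
  exact nonneg_or_nonpos hc

/-! ### Simple reflections -/

theorem simpleReflection_apply (i : Fin 6) (v : V) :
    simpleReflection i v = v - inner ℝ (simpleRoot i) v • simpleRoot i := by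
  rw [simpleReflection, Submodule.reflection_orthogonal_apply, Submodule.reflection_singleton_apply]
  have h : ‖simpleRoot i‖ ^ 2 = 2 := by rw [← real_inner_self_eq_norm_sq, inner_simpleRoot_self]
  simp only [RCLike.ofReal_real_eq_id, id_eq, h]
  module

theorem simpleReflection_mul_self (i : Fin 6) : simpleReflection i * simpleReflection i = 1 := by
  rw [simpleReflection]
  exact Submodule.reflection_mul_reflection _

theorem simpleReflection_fundWeight (i j : Fin 6) :
    simpleReflection i (fundWeight j) = fundWeight j - if j = i then simpleRoot i else 0 := by
  rw [simpleReflection_apply, real_inner_comm, inner_fundWeight_simpleRoot]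
  split <;> simp

theorem simpleReflection_latticePoint (i : Fin 6) (c : Fin 6 → ℤ) :
    ∃ n : ℤ, simpleReflection i (latticePoint c) = latticePoint (c - Pi.single i n) := by
  -- The witness is the pairing of α_i with the lattice point, written as an integer.
  refine ⟨∑ k, ∑ j, (Pi.single i 1 : Fin 6 → ℤ) k * c j * CartanMatrix.E₆ k j, ?_⟩
  rw [latticePoint_sub, latticePoint_single, ← inner_latticePoint, latticePoint_single,
    Int.cast_one, one_smul, simpleReflection_apply]

theorem IsRoot.simpleReflection {β : V} (hβ : IsRoot β) (i : Fin 6) :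
    IsRoot (simpleReflection i β) := by
  obtain ⟨c, rfl, hc⟩ := hβ
  obtain ⟨n, hn⟩ := simpleReflection_latticePoint i c
  exact ⟨_, hn, by rw [LinearIsometryEquiv.inner_map_map, hc]⟩

/-- A simple reflection makes no positive root negative but its own simple root. -/
theorem IsRoot.eq_simpleRoot {β : V} (hβ : IsRoot β) (hpos : IsNonneg β) {i : Fin 6}
    (hneg : ¬ IsNonneg (E6h.simpleReflection i β)) : β = simpleRoot i := by
  have hneg' := (hβ.simpleReflection i).isNonneg_or.resolve_left hneg
  obtain ⟨c, rfl, hc⟩ := hβ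
  obtain ⟨n, hn⟩ := simpleReflection_latticePoint i c
  -- The reflection changes only the coordinate at α_i; every other one is nonnegative before and
  -- nonpositive after, hence zero.
  have hj : ∀ j, j ≠ i → c j = 0 := fun j hji => by
    have h1 := hneg' j
    have h2 := hpos j
    rw [hn, inner_neg_right, inner_fundWeight_latticePoint] at h1
    rw [inner_fundWeight_latticePoint] at h2
    simp only [Pi.sub_apply, Pi.single_eq_of_ne hji, sub_zero] at h1
    have : (c j : ℝ) = 0 := by linarith
    exact_mod_cast this
  have hci : c = Pi.single i (c i) := by
    ext j
    rcases eq_or_ne j i with rfl | hji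
    · simp
    · simp [hji, hj j hji]
  have h0 : (0 : ℝ) ≤ c i := by
    rw [← inner_fundWeight_latticePoint]
    exact hpos i
  rw [hci, latticePoint_single, inner_smul_left, inner_smul_right, inner_simpleRoot_self] at hc
  simp only [conj_trivial] at hc
  have h1 : (c i : ℝ) = 1 := by nlinarith
  rw [hci, latticePoint_single, h1, one_smul]

/-! ### Words -/

/-- The product of the simple reflections in a word. -/
noncomputable def wordProd (l : List (Fin 6)) : V ≃ₗᵢ[ℝ] V := (l.map simpleReflection).prod

theorem wordProd_cons (i : Fin 6) (l : List (Fin 6)) :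
    wordProd (i :: l) = simpleReflection i * wordProd l := by
  simp [wordProd]

theorem wordProd_concat (l : List (Fin 6)) (i : Fin 6) :
    wordProd (l ++ [i]) = wordProd l * simpleReflection i := by
  simp [wordProd]

theorem IsRoot.wordProd {β : V} (hβ : IsRoot β) (l : List (Fin 6)) : IsRoot (wordProd l β) := by
  induction l with
  | nil => simpa [E6h.wordProd] using hβ
  | cons i l ih =>
    rw [wordProd_cons, LinearIsometryEquiv.coe_mul, Function.comp_apply]
    exact ih.simpleReflection i

/-- If `w α_i = α_j`, then `w s_i = s_j w`. -/
theorem mul_simpleReflection {w : V ≃ₗᵢ[ℝ] V} {i j : Fin 6} (h : w (simpleRoot i) = simpleRoot j) :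
    w * simpleReflection i = simpleReflection j * w := by
  ext1 v
  simp only [LinearIsometryEquiv.coe_mul, Function.comp_apply]
  rw [simpleReflection_apply, simpleReflection_apply, map_sub, map_smul, h, ← h,
    LinearIsometryEquiv.inner_map_map]

/-- The exchange property. -/
theorem exists_wordProd_eq_mul (l : List (Fin 6)) {i : Fin 6}
    (h : ¬ IsNonneg (wordProd l (simpleRoot i))) :
    ∃ l' : List (Fin 6), l'.length + 1 = l.length ∧
      wordProd l' = wordProd l * simpleReflection i := by
  induction l with
  | nil =>
    refine absurd (fun j => ?_) h
    simp only [wordProd, List.map_nil, List.prod_nil, LinearIsometryEquiv.coe_one, id_eq]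
    rw [inner_fundWeight_simpleRoot]
    split <;> norm_num
  | cons j l ih =>
    -- The letter s_j at which the image of α_i first turns negative can be deleted: there the image
    -- is α_j, so the tail u satisfies u s_i = s_j u.
    by_cases hl : IsNonneg (wordProd l (simpleRoot i))
    · rw [wordProd_cons, LinearIsometryEquiv.coe_mul, Function.comp_apply] at h
      have hj := ((isRoot_simpleRoot i).wordProd l).eq_simpleRoot hl h
      refine ⟨l, rfl, ?_⟩
      rw [wordProd_cons, mul_assoc, mul_simpleReflection hj, ← mul_assoc,
        simpleReflection_mul_self, one_mul]
    · obtain ⟨l', hlen, hl'⟩ := ih hl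
      exact ⟨j :: l', by simp [hlen], by rw [wordProd_cons, wordProd_cons, hl', mul_assoc]⟩

/-- Since s_k fixes every fundamental weight except ζ_k, this is the recursion for both inductions
on words below. -/
theorem fundWeight_sub_wordProd_concat (l : List (Fin 6)) (i k : Fin 6) :
    fundWeight i - wordProd (l ++ [k]) (fundWeight i) =
      (fundWeight i - wordProd l (fundWeight i)) +
        if i = k then wordProd l (simpleRoot k) else 0 := by
  rw [wordProd_concat, LinearIsometryEquiv.coe_mul, Function.comp_apply,
    simpleReflection_fundWeight]
  split
  · rw [map_sub]
    abel
  · simp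

/-- A fundamental weight is the highest weight in its orbit. -/
theorem isNonneg_fundWeight_sub (l : List (Fin 6)) (i : Fin 6) :
    IsNonneg (fundWeight i - wordProd l (fundWeight i)) := by
  induction hn : l.length using Nat.strong_induction_on generalizing l with
  | _ n ih =>
    rcases List.eq_nil_or_concat' l with rfl | ⟨t, k, rfl⟩
    · simpa [wordProd] using IsNonneg.zero
    · rw [List.length_append, List.length_singleton] at hn
      -- The word need not be reduced: if the added root is not positive, exchange yields a shorter
      -- word with the same product.
      by_cases ht : IsNonneg (wordProd t (simpleRoot k))
      · rw [fundWeight_sub_wordProd_concat]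
        refine (ih _ (by omega) t rfl).add ?_
        split
        · exact ht
        · exact IsNonneg.zero
      · obtain ⟨t', hlen, ht'⟩ := exists_wordProd_eq_mul t ht
        rw [wordProd_concat, ← ht']
        exact ih _ (by omega) t' rfl

theorem exists_wordProd_eq {w : V ≃ₗᵢ[ℝ] V} (hw : w ∈ W) : ∃ l, wordProd l = w := by
  induction hw using Subgroup.closure_induction with
  | mem _ h =>
    obtain ⟨i, rfl⟩ := h
    exact ⟨[i], by simp [wordProd]⟩
  | one => exact ⟨[], rfl⟩
  | mul _ _ _ _ ha hb =>
    obtain ⟨l, rfl⟩ := ha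
    obtain ⟨m, rfl⟩ := hb
    exact ⟨l ++ m, by simp [wordProd]⟩
  | inv _ hw ha =>
    obtain ⟨l, rfl⟩ := ha
    clear hw
    refine ⟨l.reverse, ?_⟩
    rw [eq_inv_iff_mul_eq_one]
    induction l with
    | nil => simp [wordProd]
    | cons i l ih =>
      rw [List.reverse_cons, wordProd_concat, wordProd_cons, mul_assoc,
        ← mul_assoc (simpleReflection i), simpleReflection_mul_self, one_mul, ih]

/-- A prefix of a word of minimal length is minimal, and sends the next simple root to a positive
root. -/
theorem minimal_and_isNonneg_of_concat {l : List (Fin 6)} {k : Fin 6}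
    (h : ∀ l', wordProd l' = wordProd (l ++ [k]) → (l ++ [k]).length ≤ l'.length) :
    (∀ l', wordProd l' = wordProd l → l.length ≤ l'.length) ∧
      IsNonneg (wordProd l (simpleRoot k)) := by
  simp only [List.length_append, List.length_singleton] at h
  refine ⟨fun l' hl' => ?_, ?_⟩
  · have := h (l' ++ [k]) (by rw [wordProd_concat, wordProd_concat, hl'])
    simpa using this
  · by_contra hneg
    obtain ⟨l', hlen, hl'⟩ := exists_wordProd_eq_mul l hneg
    have := h l' (by rw [hl', wordProd_concat])
    omega

/-- An element of the Weyl group moves the fundamental weights that belong to its support. -/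
theorem fundWeight_sub_ne_zero {l : List (Fin 6)}
    (hl : ∀ l', wordProd l' = wordProd l → l.length ≤ l'.length) {i : Fin 6} (hi : i ∈ l) :
    fundWeight i - wordProd l (fundWeight i) ≠ 0 := by
  induction l using List.reverseRecOn with
  | nil => simp at hi
  | append_singleton t k ih =>
    obtain ⟨ht, hk⟩ := minimal_and_isNonneg_of_concat hl
    rw [fundWeight_sub_wordProd_concat]
    split
    case isTrue =>
      intro h0
      refine ((isRoot_simpleRoot k).wordProd t).ne_zero ?_
      -- Both summands pair nonnegatively with each ζ_j, so a zero sum would make every coordinate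
      -- of the root vanish.
      obtain ⟨c, hc, -⟩ := (isRoot_simpleRoot k).wordProd t
      have hc0 : c = 0 := funext fun j => by
        have h1 := isNonneg_fundWeight_sub t i j
        have h2 := hk j
        have h3 := congrArg (inner ℝ (fundWeight j)) h0
        rw [inner_add_right, inner_zero_right] at h3
        have h4 : inner ℝ (fundWeight j) (wordProd t (simpleRoot k)) = (0 : ℝ) := by linarith
        rw [hc, inner_fundWeight_latticePoint] at h4
        exact_mod_cast h4
      rw [hc, hc0]
      simp [latticePoint]
    case isFalse hik =>
      rw [add_zero]
      exact ih ht (by simpa [hik] using hi)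

/-! ### The quadratic form -/

/-- Expanding, with w an isometry, gives ⟨ζ_i, ζ_j − wζ_j⟩ + ⟨ζ_j, ζ_i − wζ_i⟩. -/
theorem inner_sub_sub_nonneg {w : V ≃ₗᵢ[ℝ] V} (hw : w ∈ W) (i j : Fin 6) :
    0 ≤ inner ℝ (fundWeight i - w (fundWeight i)) (fundWeight j - w (fundWeight j)) := by
  obtain ⟨l, rfl⟩ := exists_wordProd_eq hw
  have h1 := isNonneg_fundWeight_sub l j i
  have h2 := isNonneg_fundWeight_sub l i j
  rw [inner_sub_right] at h1 h2
  rw [inner_sub_left, inner_sub_right, inner_sub_right, LinearIsometryEquiv.inner_map_map,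
    real_inner_comm (fundWeight j) (wordProd l (fundWeight i))]
  rw [real_inner_comm] at h2
  linarith

theorem inner_sub_sub_pos {w : V ≃ₗᵢ[ℝ] V} {i : Fin 6} (hi : i ∈ support w) :
    0 < inner ℝ (fundWeight i - w (fundWeight i)) (fundWeight i - w (fundWeight i)) := by
  obtain ⟨l, ⟨rfl, hl⟩, hil⟩ := hi
  exact real_inner_self_pos.mpr (fundWeight_sub_ne_zero hl hil)

theorem weight_sub (w : V ≃ₗᵢ[ℝ] V) (a : Fin 6 → ℝ) :
    weight a - w (weight a) = ∑ i, a i • (fundWeight i - w (fundWeight i)) := by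
  simp [weight, smul_sub, Finset.sum_sub_distrib]

/-- The square length of a linear combination, as a sum over ordered pairs of indices. -/
theorem norm_sum_smul_sq {n : ℕ} {E : Type*} [NormedAddCommGroup E] [InnerProductSpace ℝ E]
    (v : Fin n → E) (a : Fin n → ℝ) :
    ‖∑ i, a i • v i‖ ^ 2 = ∑ i, ∑ j ∈ Finset.Ici i,
      (if i = j then inner ℝ (v i) (v j) else 2 * inner ℝ (v i) (v j)) * (a i * a j) := by
  have hsum : ‖∑ i, a i • v i‖ ^ 2 = ∑ i, ∑ j, inner ℝ (v i) (v j) * (a i * a j) := by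
    rw [← real_inner_self_eq_norm_sq, sum_inner]
    refine Finset.sum_congr rfl fun i _ => ?_
    rw [inner_sum]
    refine Finset.sum_congr rfl fun j _ => ?_
    rw [real_inner_smul_left, real_inner_smul_right]
    ring
  -- By symmetry the terms below the diagonal fold onto those above, which produces the factor 2.
  have hIio : ∑ i, ∑ j ∈ Finset.Iio i, inner ℝ (v i) (v j) * (a i * a j) =
      ∑ i, ∑ j ∈ Finset.Ioi i, inner ℝ (v i) (v j) * (a i * a j) := by
    rw [Finset.sum_comm' (t' := Finset.univ) (s' := fun j => Finset.Ioi j) (by simp)]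
    refine Finset.sum_congr rfl fun i _ => Finset.sum_congr rfl fun j _ => ?_
    rw [real_inner_comm, mul_comm (a i)]
  have hsplit : ∀ i : Fin n, ∑ j, inner ℝ (v i) (v j) * (a i * a j) =
      ∑ j ∈ Finset.Iio i, inner ℝ (v i) (v j) * (a i * a j) +
        ∑ j ∈ Finset.Ici i, inner ℝ (v i) (v j) * (a i * a j) := fun i => by
    rw [← Finset.sum_union (Finset.disjoint_left.mpr fun j => by simp)]
    refine Finset.sum_congr (Finset.ext fun j => ?_) fun _ _ => rfl
    simp [lt_or_ge]
  rw [hsum, Finset.sum_congr rfl fun i _ => hsplit i, Finset.sum_add_distrib, hIio,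
    ← Finset.sum_add_distrib]
  refine Finset.sum_congr rfl fun i _ => ?_
  rw [← Finset.Ioi_insert i, Finset.sum_insert (by simp), Finset.sum_insert (by simp),
    if_pos rfl, add_left_comm, ← Finset.sum_add_distrib]
  congr 1
  refine Finset.sum_congr rfl fun j hj => ?_
  rw [if_neg (Finset.mem_Ioi.mp hj).ne]
  ring

/-- A quadratic form with positive square coefficients and nonnegative mixed coefficients is
bounded on only finitely many tuples of natural numbers. -/
theorem finite_setOf_quadratic_le {n : ℕ} {q : Fin n → Fin n → ℝ} (hpos : ∀ i, 0 < q i i)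
    (hnonneg : ∀ i j, i < j → 0 ≤ q i j) (C : ℝ) :
    {a : Fin n → ℕ | ∑ i, ∑ j ∈ Finset.Ici i, q i j * ((a i : ℝ) * a j) ≤ C}.Finite := by
  -- From q_ii a_i² ≤ C and a_i ≤ a_i² for natural a_i, each a_i is at most C / q_ii; no square root
  -- is needed.
  refine (Set.finite_Iic fun i => ⌈C / q i i⌉₊).subset fun a ha i => ?_
  have hterm : ∀ k, ∀ j ∈ Finset.Ici k, 0 ≤ q k j * ((a k : ℝ) * a j) := fun k j hj => by
    refine mul_nonneg ?_ (by positivity)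
    rcases (Finset.mem_Ici.mp hj).eq_or_lt with rfl | h
    · exact (hpos k).le
    · exact hnonneg k j h
  have h1 : q i i * ((a i : ℝ) * a i) ≤ C :=
    (Finset.single_le_sum (f := fun j => q i j * ((a i : ℝ) * a j)) (hterm i) (by simp)).trans <|
      (Finset.single_le_sum (f := fun k => ∑ j ∈ Finset.Ici k, q k j * ((a k : ℝ) * a j))
        (fun k _ => Finset.sum_nonneg (hterm k)) (Finset.mem_univ i)).trans ha
  have h2 : (a i : ℝ) ≤ a i * a i := by exact_mod_cast Nat.le_mul_self (a i)
  have h3 : (a i : ℝ) ≤ C / q i i := by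
    rw [le_div_iff₀' (hpos i)]
    exact (mul_le_mul_of_nonneg_left h2 (hpos i).le).trans h1
  exact_mod_cast h3.trans (Nat.le_ceil _)

end E6h

theorem mainTheorem4 (x : E6h.KGB) (θx : E6h.V ≃ₗᵢ[ℝ] E6h.V) (hx : E6h.IsInvolutionOf x θx)
    (hfs : E6h.support θx = Set.univ) :
    {Λ : E6h.V | (∃ a : Fin 6 → ℕ, Λ = E6h.weight fun i => (a i : ℝ)) ∧
      ‖Λ - θx Λ‖ ≤ ‖(2 : ℝ) • E6h.rho‖}.Finite ∧
    ∃ q : Fin 6 → Fin 6 → ℝ, (∀ i, 0 < q i i) ∧ (∀ i j, i < j → 0 ≤ q i j) ∧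
      ∀ a : Fin 6 → ℝ, ‖E6h.weight a - θx (E6h.weight a)‖ ^ 2 =
        ∑ i, ∑ j ∈ Finset.Ici i, q i j * (a i * a j) := by
  have hquad : ∃ q : Fin 6 → Fin 6 → ℝ, (∀ i, 0 < q i i) ∧ (∀ i j, i < j → 0 ≤ q i j) ∧
      ∀ a : Fin 6 → ℝ, ‖E6h.weight a - θx (E6h.weight a)‖ ^ 2 =
        ∑ i, ∑ j ∈ Finset.Ici i, q i j * (a i * a j) := by
    let v i := E6h.fundWeight i - θx (E6h.fundWeight i)
    refine ⟨fun i j => if i = j then inner ℝ (v i) (v j) else 2 * inner ℝ (v i) (v j),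
      fun i => ?_, fun i j hij => ?_, fun a => ?_⟩
    · simpa only [if_true] using E6h.inner_sub_sub_pos (hfs ▸ Set.mem_univ i)
    · simpa only [if_neg hij.ne] using mul_nonneg zero_le_two (E6h.inner_sub_sub_nonneg hx.1 i j)
    · rw [E6h.weight_sub]
      exact E6h.norm_sum_smul_sq v a
  refine ⟨?_, hquad⟩
  obtain ⟨q, hpos, hnonneg, hq⟩ := hquad
  refine ((E6h.finite_setOf_quadratic_le hpos hnonneg (‖(2 : ℝ) • E6h.rho‖ ^ 2)).image
    fun a => E6h.weight fun i => (a i : ℝ)).subset ?_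
  rintro _ ⟨⟨a, rfl⟩, ha⟩
  refine ⟨a, ?_, rfl⟩
  rw [Set.mem_ofPred_eq, ← hq fun i => (a i : ℝ)]
  gcongr
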